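/- Let $H$ be a finite-dimensional complex Hilbert space and let $\Phi(t):\mathcal B(H)\to\mathcal B(H)$, $t\ge 0$, be a dynamical map: each $\Phi(t)$ is linear, completely positive and trace preserving, and $\Phi(0)=\mathrm{Id}$. Suppose that $\Phi$ is commutative, i.e. $\Phi(t_1)\Phi(t_2)=\Phi(t_2)\Phi(t_1)$ for all $t_1,t_2\ge 0$, and Hermitian, i.e. $\Phi(t)$ coincides with its dual map $\Phi^\dagger(t)$, defined by $\operatorname{tr}(\Phi(t)[X]\,Y)=\operatorname{tr}(X\,\Phi^\dagger(t)[Y])$. Suppose that $\Phi$ is governed by a memory kernel $K(t)$: it is continuous on $[0,\infty)$, differentiable for $t>0$, and $$\frac{d\Phi(t)}{dt}=(K*\Phi)(t)=\int_0^t K(t-t')\,\Phi(t')\,dt',\qquad t>0,\quad \Phi(0)=\mathrm{Id}.$$ Here $K$ may contain singular terms such as $\delta(t)L$: it is the distributional derivative $K=dR/dt$ of a locally integrable operator-valued function $R$ on $[0,\infty)$ (extended by $0$ to $t<0$), and $K*\Phi=\frac{d}{dt}(R*\Phi)$. Let $0<\alpha<1$, and let $s\in\mathbb C$ be such that the Laplace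 transform $\left(\frac{d\Phi}{dt}\right)_s=\int_0^\infty \frac{d\Phi(t)}{dt}e^{-st}\,dt$ exists (with $\frac{d\Phi}{dt}$ integrable on bounded intervals, as the limit of the integrals over $[0,T]$, $T\to\infty$) and $$(1-\alpha^2)\left\|\left(\tfrac{d\Phi}{dt}\right)_s\right\|_{1\to 1}<1,$$ where $\|\Psi\|_{1\to1}=\sup\{\|\Psi[X]\|_1:\|X\|_1\le 1\}$ and $\|X\|_1=\operatorname{tr}\sqrt{X^\dagger X}$. Let $\widetilde\Phi(t)$ be the map governed, in the same sense, by the uniformly dilated kernel $\alpha^2K(t)$, with $\widetilde\Phi(0)=\mathrm{Id}$. If $\frac{d\widetilde\Phi}{dt}$ exists and has a positive eigenvalue at some time $t\ge 0$ (with the one-sided derivative at $t=0$), then $\Phi$ is not P divisible; that is, it is not the case that for all $t_2>t_1\ge 0$ there is a positive linear map $V(t_2,t_1)$ with $\Phi(t_2)=V(t_2,t_1)\Phi(t_1)$. -/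

import Mathlib

set_option maxSynthPendingDepth 3

open MeasureTheory Filter Topology
open scoped ComplexOrder

namespace QDyn

/-- The algebra `B(H)` of operators on the Hilbert space `H`. -/
abbrev Op (H : Type*) [NormedAddCommGroup H] [InnerProductSpace ℂ H] : Type _ :=
  H →L[ℂ] H

/-- Linear maps `B(H) → B(H)`. -/
abbrev SuperOp (H : Type*) [NormedAddCommGroup H] [InnerProductSpace ℂ H] : Type _ :=
  Op H →L[ℂ] Op H

noncomputable section

variable {H : Type*} [NormedAddCommGroup H] [InnerProductSpace ℂ H]

/-- The trace of an operator on a finite-dimensional space. -/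
def tr (X : Op H) : ℂ := LinearMap.trace ℂ H (X : H →ₗ[ℂ] H)

/-- The trace norm `‖X‖₁ = tr |X| = tr √(X† X)`. -/
def traceNorm [CompleteSpace H] (X : Op H) : ℝ := (tr (CFC.abs X)).re

/-- The norm `‖Ψ‖_{1 → 1}` induced by the trace norm: the supremum of `‖Ψ[X]‖₁` over all `X`
with `‖X‖₁ ≤ 1`. -/
def norm11 [CompleteSpace H] (Ψ : SuperOp H) : ℝ :=
  sSup {r : ℝ | ∃ X : Op H, traceNorm X ≤ 1 ∧ traceNorm (Ψ X) = r}

/-- A positive map sends positive semidefinite operators to positive semidefinite operators. -/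
def IsPositiveMap (V : SuperOp H) : Prop :=
  ∀ X : Op H, X.IsPositive → (V X).IsPositive

/-- Positive semidefiniteness of the operator on `H ⊗ ℂᵏ` (the direct sum of `k` copies of `H`)
whose blocks are the `M i j`: its quadratic form is real and non-negative. -/
def BlockPos {k : ℕ} (M : Fin k → Fin k → Op H) : Prop :=
  ∀ v : Fin k → H, (0 : ℂ) ≤ ∑ i, ∑ j, inner ℂ (v i) (M i j (v j))

/-- Complete positivity: for every `k`, the map `V ⊗ Id_k`, which applies `V` to every block,
is positive. -/
def IsCompletelyPositive (V : SuperOp H) : Prop :=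
  ∀ (k : ℕ) (M : Fin k → Fin k → Op H), BlockPos M → BlockPos fun i j => V (M i j)

/-- Trace preservation. -/
def IsTracePreserving (V : SuperOp H) : Prop :=
  ∀ X : Op H, tr (V X) = tr X

/-- A dynamical map: completely positive and trace preserving at all times `t ≥ 0`, and the
identity at `t = 0`. -/
structure IsDynamicalMap (Φ : ℝ → SuperOp H) : Prop where
  zero : Φ 0 = ContinuousLinearMap.id ℂ (Op H)
  cp : ∀ t, 0 ≤ t → IsCompletelyPositive (Φ t)
  tp : ∀ t, 0 ≤ t → IsTracePreserving (Φ t)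

/-- Commutativity: `Φ(t₁) Φ(t₂) = Φ(t₂) Φ(t₁)` for all `t₁, t₂ ≥ 0`. -/
def IsCommutative (Φ : ℝ → SuperOp H) : Prop :=
  ∀ t₁ t₂, 0 ≤ t₁ → 0 ≤ t₂ → (Φ t₁).comp (Φ t₂) = (Φ t₂).comp (Φ t₁)

/-- Hermiticity: `Φ(t)` coincides with its Heisenberg dual `Φ†(t)`, the map determined by
`tr (Φ(t)[X] Y) = tr (X Φ†(t)[Y])`. -/
def IsHermitian (Φ : ℝ → SuperOp H) : Prop :=
  ∀ t, 0 ≤ t → ∀ X Y : Op H, tr (Φ t X * Y) = tr (X * Φ t Y)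

/-- P divisibility: for all `t₂ > t₁ ≥ 0` there is a positive map `V(t₂, t₁)` with
`Φ(t₂) = V(t₂, t₁) Φ(t₁)`. -/
def IsPDivisible (Φ : ℝ → SuperOp H) : Prop :=
  ∀ t₁ t₂, 0 ≤ t₁ → t₁ < t₂ → ∃ V : SuperOp H, IsPositiveMap V ∧ Φ t₂ = V.comp (Φ t₁)

variable (H) in
/-- A memory kernel `K(t)`, `t ≥ 0`. Kernels may contain singular terms such as `δ(t) L`, so `K` is
an operator-valued distribution supported on `[0, ∞)`. It is represented by its primitive
`R(t) = ∫_{[0, t]} K(t') dt'`, a locally integrable function on `[0, ∞)` with `K = dR/dt`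
(where `R = 0` for `t < 0`). An integrable kernel `k` has `R(t) = ∫₀ᵗ k(t') dt'`, and the kernel
`δ(t) L` has `R(t) = L` for all `t > 0`. -/
structure MemoryKernel where
  primitive : ℝ → SuperOp H
  locallyIntegrable : ∀ T, 0 ≤ T → IntervalIntegrable primitive volume 0 T

/-- The rescaled kernel `c K(t)`. -/
def MemoryKernel.scale (c : ℝ) (K : MemoryKernel H) : MemoryKernel H where
  primitive t := c • K.primitive t
  locallyIntegrable T hT := (K.locallyIntegrable T hT).smul c

/-- `(A ∗ B)(t) = ∫₀ᵗ A(t - t') B(t') dt'`. -/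
def conv (A B : ℝ → SuperOp H) (t : ℝ) : SuperOp H :=
  ∫ u in (0 : ℝ)..t, (A (t - u)).comp (B u)

/-- `(K ∗ Φ)(t)` exists and equals `D`. As `K = dR/dt`, the convolution is
`K ∗ Φ = d/dt (R ∗ Φ)`. For `K(t) = δ(t) L + k(t)` this is `L Φ(t) + (k ∗ Φ)(t)`. -/
def MemoryKernel.HasConvAt (K : MemoryKernel H) (Φ : ℝ → SuperOp H) (D : SuperOp H) (t : ℝ) :
    Prop :=
  HasDerivAt (conv K.primitive Φ) D t

/-- `Φ` is governed by the memory kernel `K`: it is the identity at time `0`, continuous, and solves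
`dΦ(t)/dt = (K ∗ Φ)(t)` at all times `t > 0`. -/
structure IsGovernedBy (K : MemoryKernel H) (Φ : ℝ → SuperOp H) : Prop where
  zero : Φ 0 = ContinuousLinearMap.id ℂ (Op H)
  cont : ContinuousOn Φ (Set.Ici 0)
  eqn : ∀ t, 0 < t → ∃ D : SuperOp H, HasDerivAt Φ D t ∧ K.HasConvAt Φ D t

/-- The Laplace transform `∫₀^∞ f(t) e^{-st} dt` exists (as the limit of the integrals over
`[0, T]`) and equals `F`. -/
def HasLaplaceTransform (f : ℝ → SuperOp H) (s : ℂ) (F : SuperOp H) : Prop :=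
  (∀ T, 0 ≤ T → IntervalIntegrable f volume 0 T) ∧
    Tendsto (fun T : ℝ => ∫ t in (0 : ℝ)..T, Complex.exp (-(s * (t : ℂ))) • f t) atTop (𝓝 F)

end

end QDyn

/-! Suppose `Φ` is P divisible. Each `Φ t` is symmetric for the Hilbert-Schmidt inner product and
the family commutes, so the operators are spanned by common eigenvectors with real eigenvalues `l
t`. Duality and trace preservation make `Φ t` unital, so the intermediate maps fix the identity and
contract the operator norm on Hermitian operators. Hence `|l|` is non-increasing; as `l 0 = 1` and
`l` stays at zero once it gets there, `0 ≤ l` and `l = 1 - ∫ h` with `h ≥ 0`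
(`IsJointEigenvector.exists_density`).

Let `m` be a left eigenfunctional, `m ∘ Φ t = l t • m`, and let `y t = m (Φt t Y)` with `m Y = 1`.
Formally, in Laplace variables, `l = 1 / (s - k)` and `y = 1 / (s - α² k)` for the same scalar
kernel `k`. Eliminating `k` through `h = 1 - s l = -k l` gives the renewal equation `y = l + (1 -
α²) h ∗ y`. The file derives it in the time domain, with `volterraConv_map_primitive` supplying the
diagonal action of the kernel.

The kernel `(1 - α²) h` is non-negative with mass below one, so a maximum principle applies, and `y`
is non-increasing (`antitoneOn_of_eq_add_volterraConv`). If `Y` is an eigenvector of the derivative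
of `Φt` with eigenvalue `c > 0`, then `y` has derivative `c` at that time, a contradiction. -/

/-! ### Spectral facts on inner product spaces -/

/-- Operators already carry the operator norm, so the Hilbert-Schmidt product enters as a `Core` and
is an instance only inside this proof. -/
theorem iSup_iInf_eigenspace_eq_top_of_core {V ι : Type*} [AddCommGroup V] [Module ℂ V]
    [FiniteDimensional ℂ V] (c : InnerProductSpace.Core ℂ V) (T : ι → Module.End ℂ V)
    (hT : ∀ i x y, c.inner (T i x) y = c.inner x (T i y))
    (hcomm : ∀ i j, Commute (T i) (T j)) :
    ⨆ χ : ι → ℂ, ⨅ i, Module.End.eigenspace (T i) (χ i) = ⊤ := by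
  let _ : NormedAddCommGroup V := c.toNormedAddCommGroup
  let _ : InnerProductSpace ℂ V := InnerProductSpace.ofCore c.toCore
  exact LinearMap.IsSymmetric.iSup_iInf_eq_top_of_commute (fun i x y => hT i x y)
    (fun i j _ => hcomm i j)

/-- The norm of a symmetric operator is the supremum of its absolute Rayleigh quotients, and the two
positivity conditions bound these by `N`. -/
theorem ContinuousLinearMap.norm_le_of_isPositive_sub_of_isPositive_add {H : Type*}
    [NormedAddCommGroup H] [InnerProductSpace ℂ H] {T : H →L[ℂ] H}
    (hT : (T : H →ₗ[ℂ] H).IsSymmetric) {N : ℝ} (hN : 0 ≤ N)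
    (h₁ : ((N : ℂ) • (1 : H →L[ℂ] H) - T).IsPositive)
    (h₂ : ((N : ℂ) • (1 : H →L[ℂ] H) + T).IsPositive) : ‖T‖ ≤ N := by
  rw [norm_eq_iSup_rayleighQuotient T hT]
  refine ciSup_le fun v => ?_
  have e₁ := h₁.re_inner_nonneg_left v
  have e₂ := h₂.re_inner_nonneg_left v
  simp only [sub_apply, add_apply, smul_apply, one_apply_eq_self, inner_sub_left, inner_add_left,
    inner_smul_left, Complex.conj_ofReal, inner_self_eq_norm_sq_to_K, map_sub, map_add] at e₁ e₂
  norm_cast at e₁ e₂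
  simp only [RCLike.re_to_complex, Complex.re_ofReal_mul] at e₁ e₂
  change 0 ≤ N * ‖v‖ ^ 2 - _ at e₁
  change 0 ≤ N * ‖v‖ ^ 2 + _ at e₂
  rw [rayleighQuotient, abs_div, abs_of_nonneg (sq_nonneg ‖v‖)]
  refine div_le_of_le_mul₀ (sq_nonneg _) hN (abs_le.2 ⟨?_, ?_⟩)
  · change _ ≤ (inner ℂ (T v) v).re
    linarith
  · change (inner ℂ (T v) v).re ≤ _
    linarith

/-! ### Positive maps -/

namespace QDyn

noncomputable section

variable {H : Type*} [NormedAddCommGroup H] [InnerProductSpace ℂ H]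

theorem IsCompletelyPositive.isPositiveMap {V : SuperOp H} (hV : IsCompletelyPositive V) :
    IsPositiveMap V := by
  intro X hX
  have h := hV 1 (fun _ _ => X) fun v => by simpa using hX.inner_nonneg_right (v 0)
  rw [ContinuousLinearMap.isPositive_iff_complex]
  intro x
  have hx : 0 ≤ inner ℂ x (V X x) := by simpa using h fun _ => x
  rw [Complex.nonneg_iff] at hx
  have hs : inner ℂ (V X x) x = inner ℂ x (V X x) := by
    rw [← inner_conj_symm]
    exact Complex.conj_eq_iff_im.2 hx.2.symm
  rw [hs]
  exact ⟨Complex.ext (by simp) (by simp [← hx.2]), hx.1⟩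

theorem IsPositiveMap.smul_one_add {V : SuperOp H} (hV : IsPositiveMap V) (hV₁ : V 1 = 1)
    {N : ℂ} {X : Op H} (hX : (N • (1 : Op H) + X).IsPositive) :
    (N • (1 : Op H) + V X).IsPositive := by
  simpa [hV₁] using hV _ hX

theorem tr_mul_comm (X Y : Op H) : tr (X * Y) = tr (Y * X) :=
  LinearMap.trace_mul_comm ℂ (X : H →ₗ[ℂ] H) (Y : H →ₗ[ℂ] H)

theorem tr_eq_sum {ι : Type*} [Fintype ι] (b : OrthonormalBasis ι ℂ H) (X : Op H) :
    tr X = ∑ i, inner ℂ (b i) (X (b i)) :=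
  LinearMap.trace_eq_sum_inner (X : H →ₗ[ℂ] H) b

/-- `X` is a common eigenvector of all the `Φ(t)`, `t ≥ 0`, with real eigenvalues `l t`. -/
structure IsJointEigenvector (Φ : ℝ → SuperOp H) (l : ℝ → ℝ) (X : Op H) : Prop where
  ne_zero : X ≠ 0
  map_eq : ∀ t, 0 ≤ t → Φ t X = (l t : ℂ) • X

variable {Φ : ℝ → SuperOp H}

theorem IsJointEigenvector.eigenvalue_zero {l : ℝ → ℝ} {X : Op H} (hX : IsJointEigenvector Φ l X)
    (hdyn : IsDynamicalMap Φ) : l 0 = 1 := by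
  have h := hX.map_eq 0 le_rfl
  rw [hdyn.zero, ContinuousLinearMap.id_apply] at h
  have h' : ((l 0 : ℂ) - 1) • X = 0 := by rw [sub_smul, ← h, one_smul, sub_self]
  have h'' := (smul_eq_zero.1 h').resolve_right hX.ne_zero
  exact_mod_cast sub_eq_zero.1 h''

theorem IsJointEigenvector.continuousOn {l : ℝ → ℝ} {X : Op H} (hX : IsJointEigenvector Φ l X)
    (hΦ : ContinuousOn Φ (Set.Ici 0)) : ContinuousOn l (Set.Ici 0) := by
  obtain ⟨m, -, hm⟩ := exists_dual_vector ℂ X (norm_ne_zero_iff.2 hX.ne_zero)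
  have h : ContinuousOn (fun t => (m (Φ t X)).re / ‖X‖) (Set.Ici 0) := by fun_prop
  refine h.congr fun t ht => ?_
  have : ‖X‖ ≠ 0 := norm_ne_zero_iff.2 hX.ne_zero
  simp [hX.map_eq t ht, hm, this]

section

variable [CompleteSpace H]

theorem isPositive_norm_smul_one_sub {X : Op H} (hX : IsSelfAdjoint X) :
    (((‖X‖ : ℝ) : ℂ) • (1 : Op H) - X).IsPositive := by
  have h := hX.le_algebraMap_norm_self
  rwa [ContinuousLinearMap.le_def, Algebra.algebraMap_eq_smul_one,
    RCLike.real_smul_eq_coe_smul (K := ℂ)] at h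

theorem isPositive_norm_smul_one_add {X : Op H} (hX : IsSelfAdjoint X) :
    (((‖X‖ : ℝ) : ℂ) • (1 : Op H) + X).IsPositive := by
  simpa using isPositive_norm_smul_one_sub hX.neg

/-- A Hermitian `X` is the difference of the positive operators `‖X‖ + X` and `‖X‖`. -/
theorem IsPositiveMap.isSelfAdjoint {V : SuperOp H} (hV : IsPositiveMap V) {X : Op H}
    (hX : IsSelfAdjoint X) : IsSelfAdjoint (V X) := by
  have h₁ := (hV _ (isPositive_norm_smul_one_add hX)).isSelfAdjoint
  have h₂ := (hV (((‖X‖ : ℝ) : ℂ) • (1 : Op H))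
    (ContinuousLinearMap.isPositive_one.smul_of_nonneg
      (Complex.zero_le_real.2 (norm_nonneg X)))).isSelfAdjoint
  simpa using h₁.sub h₂

theorem IsPositiveMap.map_star {V : SuperOp H} (hV : IsPositiveMap V) (X : Op H) :
    V (star X) = star (V X) := by
  have h₁ := (hV.isSelfAdjoint (realPart X).2).star_eq
  have h₂ := (hV.isSelfAdjoint (imaginaryPart X).2).star_eq
  conv_rhs => rw [← realPart_add_I_smul_imaginaryPart X]
  conv_lhs => rw [← realPart_add_I_smul_imaginaryPart X]
  simp only [star_add, star_smul, map_add, map_smul, h₁, h₂, (realPart X).2.star_eq,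
    (imaginaryPart X).2.star_eq]

/-- A positive unital map does not increase the operator norm of Hermitian operators. -/
theorem IsPositiveMap.norm_le {V : SuperOp H} (hV : IsPositiveMap V) (hV₁ : V 1 = 1)
    {X : Op H} (hX : IsSelfAdjoint X) : ‖V X‖ ≤ ‖X‖ := by
  refine ContinuousLinearMap.norm_le_of_isPositive_sub_of_isPositive_add
    (hV.isSelfAdjoint hX).isSymmetric (norm_nonneg _) ?_
    (hV.smul_one_add hV₁ (isPositive_norm_smul_one_add hX))
  have h := hV.smul_one_add hV₁ (N := ((‖X‖ : ℝ) : ℂ)) (X := -X) (by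
    rw [← sub_eq_add_neg]
    exact isPositive_norm_smul_one_sub hX)
  rwa [map_neg, ← sub_eq_add_neg] at h

end

/-! ### Hilbert-Schmidt geometry, joint eigenvectors and P divisibility -/

variable [FiniteDimensional ℂ H]

variable (H) in
/-- The trace as a continuous linear functional. -/
def trL : Op H →L[ℂ] ℂ :=
  LinearMap.toContinuousLinearMap
    ((LinearMap.trace ℂ H).comp (ContinuousLinearMap.coeLM ℂ : (H →L[ℂ] H) →ₗ[ℂ] _))

@[simp] theorem trL_apply (X : Op H) : trL H X = tr X := rfl

theorem tr_add (X Y : Op H) : tr (X + Y) = tr X + tr Y := map_add (trL H) X Y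

theorem tr_smul (c : ℂ) (X : Op H) : tr (c • X) = c * tr X := map_smul (trL H) c X

variable [CompleteSpace H]

theorem tr_star (X : Op H) : tr (star X) = starRingEnd ℂ (tr X) := by
  rw [tr_eq_sum (stdOrthonormalBasis ℂ H), tr_eq_sum (stdOrthonormalBasis ℂ H), map_sum]
  refine Finset.sum_congr rfl fun i _ => ?_
  rw [ContinuousLinearMap.star_eq_adjoint, ContinuousLinearMap.adjoint_inner_right,
    inner_conj_symm]

theorem tr_star_mul_self (X : Op H) :
    tr (star X * X) = ((∑ i, ‖X (stdOrthonormalBasis ℂ H i)‖ ^ 2 : ℝ) : ℂ) := by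
  rw [tr_eq_sum (stdOrthonormalBasis ℂ H), Complex.ofReal_sum]
  refine Finset.sum_congr rfl fun i _ => ?_
  rw [ContinuousLinearMap.star_eq_adjoint, mul_apply_eq_comp,
    ContinuousLinearMap.adjoint_inner_right, inner_self_eq_norm_sq_to_K]
  norm_cast

theorem eq_zero_of_tr_star_mul_self {X : Op H} (h : tr (star X * X) = 0) : X = 0 := by
  rw [tr_star_mul_self, Complex.ofReal_eq_zero,
    Finset.sum_eq_zero_iff_of_nonneg fun i _ => by positivity] at h
  apply ContinuousLinearMap.coe_injective
  refine (stdOrthonormalBasis ℂ H).toBasis.ext fun i => ?_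
  simpa using h i (Finset.mem_univ i)

variable (H) in
/-- The Hilbert-Schmidt inner product `tr (X† Y)`. -/
@[reducible]
def hsCore : InnerProductSpace.Core ℂ (Op H) where
  inner X Y := tr (star X * Y)
  conj_inner_symm X Y := by rw [← tr_star, star_mul, star_star]
  re_inner_nonneg X := by
    rw [tr_star_mul_self, RCLike.re_to_complex, Complex.ofReal_re]
    positivity
  add_left X Y Z := by rw [star_add, add_mul, tr_add]
  smul_left X Y c := by rw [star_smul, smul_mul_assoc, tr_smul]; rfl
  definite X h := eq_zero_of_tr_star_mul_self h

theorem eq_of_forall_tr_mul_eq {X Z : Op H} (h : ∀ Y : Op H, tr (X * Y) = tr (Z * Y)) : X = Z := by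
  refine sub_eq_zero.1 (eq_zero_of_tr_star_mul_self ?_)
  rw [tr_mul_comm, sub_mul, ← trL_apply, map_sub, trL_apply, trL_apply, h, sub_self]

theorem IsDynamicalMap.map_one (hdyn : IsDynamicalMap Φ) (hherm : IsHermitian Φ) {t : ℝ}
    (ht : 0 ≤ t) : Φ t 1 = 1 := by
  refine eq_of_forall_tr_mul_eq fun Y => ?_
  rw [hherm t ht, one_mul, one_mul, hdyn.tp t ht]

theorem IsDynamicalMap.tr_star_map_mul (hdyn : IsDynamicalMap Φ) (hherm : IsHermitian Φ) {t : ℝ}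
    (ht : 0 ≤ t) (X Y : Op H) : tr (star (Φ t X) * Y) = tr (star X * Φ t Y) := by
  rw [← (hdyn.cp t ht).isPositiveMap.map_star, hherm t ht]

/-- The common eigenvectors of a commutative Hermitian dynamical map span the operator algebra. -/
theorem IsDynamicalMap.induction_joint_eigenvector (hdyn : IsDynamicalMap Φ)
    (hcomm : IsCommutative Φ) (hherm : IsHermitian Φ) {P : Op H → Prop} (zero : P 0)
    (add : ∀ X Y, P X → P Y → P (X + Y))
    (eig : ∀ l X, IsJointEigenvector Φ l X → P X) (X : Op H) : P X := by
  have htop := iSup_iInf_eigenspace_eq_top_of_core (hsCore H)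
    (fun t : {t : ℝ // 0 ≤ t} => (Φ t : Op H →ₗ[ℂ] Op H))
    (fun t X Y => hdyn.tr_star_map_mul hherm t.2 X Y)
    (fun t₁ t₂ => LinearMap.ext fun Z => DFunLike.congr_fun (hcomm t₁ t₂ t₁.2 t₂.2) Z)
  have hX : X ∈ (⊤ : Submodule ℂ (Op H)) := Submodule.mem_top
  rw [← htop] at hX
  induction hX using Submodule.iSup_induction' with
  | zero => exact zero
  | add X Y _ _ hX hY => exact add X Y hX hY
  | mem χ X hX =>
    by_cases h0 : X = 0
    · exact h0 ▸ zero
    have hmap : ∀ t, ∀ ht : 0 ≤ t, Φ t X = χ ⟨t, ht⟩ • X := fun t ht =>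
      Module.End.mem_eigenspace_iff.1 ((Submodule.mem_iInf _).1 hX ⟨t, ht⟩)
    -- Symmetry forces each eigenvalue to equal its conjugate, so taking real parts loses nothing;
    -- the value `0` at negative times is a dummy.
    refine eig (fun t => if ht : 0 ≤ t then (χ ⟨t, ht⟩).re else 0) X ⟨h0, fun t ht => ?_⟩
    have h := hdyn.tr_star_map_mul hherm ht X X
    rw [hmap t ht, star_smul, smul_mul_assoc, mul_smul_comm, tr_smul, tr_smul] at h
    have h' := mul_right_cancel₀ (fun h => h0 (eq_zero_of_tr_star_mul_self h)) h
    rw [dif_pos ht, Complex.conj_eq_iff_re.1 h', hmap t ht]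

/-- The eigenvalues are real and `Φ t` commutes with the adjoint, so `X + X†` serves, or `i X` when
that sum vanishes. The contraction estimate needs a Hermitian eigenvector. -/
theorem IsJointEigenvector.exists_isSelfAdjoint {l : ℝ → ℝ} {X : Op H}
    (hX : IsJointEigenvector Φ l X) (hdyn : IsDynamicalMap Φ) :
    ∃ Y, IsJointEigenvector Φ l Y ∧ IsSelfAdjoint Y := by
  have hs : ∀ t, 0 ≤ t → Φ t (star X) = (l t : ℂ) • star X := fun t ht => by
    rw [(hdyn.cp t ht).isPositiveMap.map_star, hX.map_eq t ht, star_smul]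
    simp
  have hr : ∀ t, 0 ≤ t → ∀ a b : ℂ, Φ t (a • X + b • star X)
      = (l t : ℂ) • (a • X + b • star X) := fun t ht a b => by
    rw [map_add, map_smul, map_smul, hX.map_eq t ht, hs t ht, smul_add, smul_comm a,
      smul_comm b]
  by_cases h : X + star X = 0
  · refine ⟨Complex.I • X, ⟨smul_ne_zero Complex.I_ne_zero hX.ne_zero, fun t ht => ?_⟩, ?_⟩
    · simpa using hr t ht Complex.I 0
    · rw [isSelfAdjoint_iff, star_smul, eq_neg_of_add_eq_zero_right h]
      simp
  · refine ⟨X + star X, ⟨h, fun t ht => ?_⟩, IsSelfAdjoint.add_star_self X⟩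
    simpa using hr t ht 1 1

theorem IsJointEigenvector.abs_le {l : ℝ → ℝ} {X : Op H} (hX : IsJointEigenvector Φ l X)
    (hdyn : IsDynamicalMap Φ) (hherm : IsHermitian Φ) (hdiv : IsPDivisible Φ) {t₁ t₂ : ℝ}
    (h₁ : 0 ≤ t₁) (h₁₂ : t₁ < t₂) : |l t₂| ≤ |l t₁| := by
  obtain ⟨Y, hY, hYs⟩ := hX.exists_isSelfAdjoint hdyn
  obtain ⟨V, hV, hΦ⟩ := hdiv t₁ t₂ h₁ h₁₂
  have h₂ : 0 ≤ t₂ := h₁.trans h₁₂.le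
  have hV₁ : V 1 = 1 := by
    have h := hdyn.map_one hherm h₂
    rwa [hΦ, ContinuousLinearMap.comp_apply, hdyn.map_one hherm h₁] at h
  have hle := hV.norm_le hV₁ (hdyn.cp t₁ h₁ |>.isPositiveMap.isSelfAdjoint hYs)
  rw [← ContinuousLinearMap.comp_apply, ← hΦ, hY.map_eq t₂ h₂, hY.map_eq t₁ h₁, norm_smul,
    norm_smul, Complex.norm_real, Complex.norm_real] at hle
  exact le_of_mul_le_mul_right hle (norm_pos_iff.2 hY.ne_zero)

/-- A negative value would be preceded by a zero of `l`, since `l 0 = 1`; after a zero, monotonicity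
of `|l|` keeps `l` at zero. -/
theorem IsJointEigenvector.eigenvalue_nonneg {l : ℝ → ℝ} {X : Op H}
    (hX : IsJointEigenvector Φ l X) (hdyn : IsDynamicalMap Φ) (hherm : IsHermitian Φ)
    (hdiv : IsPDivisible Φ) (hΦ : ContinuousOn Φ (Set.Ici 0)) {t : ℝ} (ht : 0 ≤ t) : 0 ≤ l t := by
  by_contra! hneg
  have hmem : (0 : ℝ) ∈ Set.Icc (l t) (l 0) := ⟨hneg.le, by simp [hX.eigenvalue_zero hdyn]⟩
  obtain ⟨u, hu, hu0⟩ := intermediate_value_Icc' ht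
    ((hX.continuousOn hΦ).mono Set.Icc_subset_Ici_self) hmem
  rcases hu.2.eq_or_lt with rfl | hlt
  · exact hneg.ne hu0
  · have := hX.abs_le hdyn hherm hdiv hu.1 hlt
    rw [hu0, abs_zero] at this
    exact hneg.ne (abs_nonpos_iff.1 this)

theorem IsJointEigenvector.antitoneOn {l : ℝ → ℝ} {X : Op H}
    (hX : IsJointEigenvector Φ l X) (hdyn : IsDynamicalMap Φ) (hherm : IsHermitian Φ)
    (hdiv : IsPDivisible Φ) (hΦ : ContinuousOn Φ (Set.Ici 0)) : AntitoneOn l (Set.Ici 0) := by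
  intro t₁ h₁ t₂ h₂ h₁₂
  rcases h₁₂.eq_or_lt with rfl | hlt
  · exact le_rfl
  · have := hX.abs_le hdyn hherm hdiv h₁ hlt
    rwa [abs_of_nonneg (hX.eigenvalue_nonneg hdyn hherm hdiv hΦ h₁),
      abs_of_nonneg (hX.eigenvalue_nonneg hdyn hherm hdiv hΦ h₂)] at this

end

end QDyn

/-! ### Real Volterra equations -/

/-- Fubini's theorem on a triangle, for a weighted integral of a Volterra convolution. -/
theorem integral_mul_integral_conv {E F : Type*} [NormedAddCommGroup E] [NormedSpace ℝ E]
    [NormedAddCommGroup F] [NormedSpace ℝ F] (L : E →L[ℝ] F →L[ℝ] ℝ) {w : ℝ → ℝ} {g : ℝ → E}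
    {f : ℝ → F} {T : ℝ} (hT : 0 ≤ T) (hw : ContinuousOn w (Set.Icc 0 T))
    (hg : IntervalIntegrable g volume 0 T) (hf : IntervalIntegrable f volume 0 T) :
    ∫ s in (0 : ℝ)..T, w (T - s) * ∫ u in (0 : ℝ)..s, L (g (s - u)) (f u) =
      ∫ u in (0 : ℝ)..T, ∫ v in (0 : ℝ)..T - u, w (T - u - v) * L (g v) (f u) := by
  -- Extension by zero turns the triangle into the whole plane, where the integrand is a bounded
  -- weight times an integrable convolution integrand.
  set G := (Set.Ioc 0 T).indicator g with hGdef
  set K := (Set.Ioc 0 T).indicator f with hKdef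
  set W := (Set.Ioc 0 T).indicator (fun s => w (T - s)) with hWdef
  have hG : Integrable G := (integrable_indicator_iff measurableSet_Ioc).2
    ((intervalIntegrable_iff_integrableOn_Ioc_of_le hT).1 hg)
  have hK : Integrable K := (integrable_indicator_iff measurableSet_Ioc).2
    ((intervalIntegrable_iff_integrableOn_Ioc_of_le hT).1 hf)
  have hw' : ContinuousOn (fun s => w (T - s)) (Set.Icc 0 T) :=
    hw.comp (by fun_prop) fun s hs => ⟨by linarith [hs.2], by linarith [hs.1]⟩
  have hWm : AEStronglyMeasurable W := (aestronglyMeasurable_indicator_iff measurableSet_Ioc).2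
    ((hw'.mono Set.Ioc_subset_Icc_self).aestronglyMeasurable measurableSet_Ioc)
  obtain ⟨C, hC⟩ := isCompact_Icc.exists_bound_of_continuousOn hw'
  have hWb : ∀ s, ‖W s‖ ≤ max C 0 := fun s => by
    by_cases hs : s ∈ Set.Ioc 0 T
    · rw [hWdef, Set.indicator_of_mem hs]
      exact (hC s (Set.Ioc_subset_Icc_self hs)).trans (le_max_left _ _)
    · rw [hWdef, Set.indicator_of_notMem hs, norm_zero]
      exact le_max_right _ _
  have hk : Integrable (Function.uncurry fun s u => W s * L (G (s - u)) (K u))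
      (volume.prod volume) :=
    (hK.convolution_integrand L.flip hG).bdd_mul (f := fun p : ℝ × ℝ => W p.1) (c := max C 0)
      hWm.comp_fst (ae_of_all _ fun p => hWb p.1)
  have hswap := integral_integral_swap hk
  have hleft : ∫ s, ∫ u, W s * L (G (s - u)) (K u) =
      ∫ s in (0 : ℝ)..T, w (T - s) * ∫ u in (0 : ℝ)..s, L (g (s - u)) (f u) := by
    rw [intervalIntegral.integral_of_le hT, ← integral_indicator measurableSet_Ioc]
    refine integral_congr_ae (ae_of_all _ fun s => ?_)
    by_cases hs : s ∈ Set.Ioc 0 T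
    · simp only [hWdef, Set.indicator_of_mem hs]
      rw [integral_const_mul, intervalIntegral.integral_of_le hs.1.le, integral_Ioc_eq_integral_Ioo,
        ← integral_indicator measurableSet_Ioo]
      congr 2
      ext u
      by_cases hu : u ∈ Set.Ioo 0 s
      · have m₁ : s - u ∈ Set.Ioc 0 T := ⟨by linarith [hu.2], by linarith [hu.1, hs.2]⟩
        have m₂ : u ∈ Set.Ioc 0 T := ⟨hu.1, by linarith [hu.2, hs.2]⟩
        rw [Set.indicator_of_mem hu, hGdef, hKdef, Set.indicator_of_mem m₁,
          Set.indicator_of_mem m₂]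
      · rw [Set.indicator_of_notMem hu]
        by_cases hu0 : 0 < u
        · rw [hGdef, Set.indicator_of_notMem, map_zero, zero_apply]
          exact fun h => hu ⟨hu0, by linarith [h.1]⟩
        · rw [hKdef, Set.indicator_of_notMem, map_zero]
          exact fun h => hu0 h.1
    · simp only [hWdef, Set.indicator_of_notMem hs, zero_mul, integral_zero]
  have hright : ∫ u, ∫ s, W s * L (G (s - u)) (K u) =
      ∫ u in (0 : ℝ)..T, ∫ v in (0 : ℝ)..T - u, w (T - u - v) * L (g v) (f u) := by
    rw [intervalIntegral.integral_of_le hT, ← integral_indicator measurableSet_Ioc]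
    refine integral_congr_ae (ae_of_all _ fun u => ?_)
    by_cases hu : u ∈ Set.Ioc 0 T
    · have h := intervalIntegral.integral_comp_sub_right (a := u) (b := T)
        (fun v => w (T - u - v) * L (g v) (f u)) u
      rw [sub_self] at h
      simp only [hKdef, Set.indicator_of_mem hu]
      rw [← h, intervalIntegral.integral_of_le hu.2, ← integral_indicator measurableSet_Ioc]
      congr 1
      ext s
      by_cases hs : s ∈ Set.Ioc u T
      · have m₁ : s - u ∈ Set.Ioc 0 T := ⟨by linarith [hs.1], by linarith [hs.2, hu.1]⟩
        have m₂ : s ∈ Set.Ioc 0 T := ⟨by linarith [hs.1, hu.1], hs.2⟩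
        rw [Set.indicator_of_mem hs, hGdef, hWdef, Set.indicator_of_mem m₁,
          Set.indicator_of_mem m₂, sub_sub_sub_cancel_right]
      · rw [Set.indicator_of_notMem hs]
        by_cases hs0 : u < s
        · rw [hWdef, Set.indicator_of_notMem, zero_mul]
          exact fun h => hs ⟨hs0, h.2⟩
        · rw [hGdef, Set.indicator_of_notMem, map_zero, zero_apply, mul_zero]
          exact fun h => hs0 (by linarith [h.1])
    · simp only [hKdef, Set.indicator_of_notMem hu, map_zero, mul_zero, integral_zero]
  rw [← hleft, ← hright, hswap]

theorem intervalIntegral.integral_nonneg_of_Ioo {a b : ℝ} (hab : a ≤ b) {h : ℝ → ℝ}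
    (hh : ∀ u ∈ Set.Ioo a b, 0 ≤ h u) : 0 ≤ ∫ u in a..b, h u := by
  rw [intervalIntegral.integral_of_le hab, integral_Ioc_eq_integral_Ioo]
  exact setIntegral_nonneg measurableSet_Ioo hh

/-- The Volterra convolution `(a ∗ b)(t) = ∫₀ᵗ a(t - u) b(u) du` of real functions. -/
noncomputable def volterraConv (a b : ℝ → ℝ) (t : ℝ) : ℝ :=
  ∫ u in (0 : ℝ)..t, a (t - u) * b u

theorem volterraConv_comm (a b : ℝ → ℝ) (t : ℝ) : volterraConv a b t = volterraConv b a t := by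
  have h := intervalIntegral.integral_comp_sub_left (a := 0) (b := t)
    (fun u => a (t - u) * b u) t
  simp only [sub_self, sub_zero, sub_sub_cancel] at h
  rw [volterraConv, volterraConv, ← h]
  simp only [mul_comm]

theorem volterraConv_congr {a a' b b' : ℝ → ℝ} {t : ℝ} (ht : 0 ≤ t)
    (ha : ∀ s, 0 ≤ s → a s = a' s) (hb : ∀ s, 0 ≤ s → b s = b' s) :
    volterraConv a b t = volterraConv a' b' t := by
  refine intervalIntegral.integral_congr fun u hu => ?_
  rw [Set.uIcc_of_le ht] at hu
  simp only [ha _ (sub_nonneg.2 hu.2), hb u hu.1]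

theorem ContinuousOn.intervalIntegrable_comp_sub_mul {y b : ℝ → ℝ} {t : ℝ} (ht : 0 ≤ t)
    (hy : ContinuousOn y (Set.Icc 0 t)) (hb : IntervalIntegrable b volume 0 t) :
    IntervalIntegrable (fun u => y (t - u) * b u) volume 0 t := by
  refine hb.continuousOn_mul (hy.comp (by fun_prop) fun u hu => ?_)
  rw [Set.uIcc_of_le ht] at hu
  exact ⟨by linarith [hu.2], by linarith [hu.1]⟩

theorem integral_volterraConv {a b : ℝ → ℝ} {t : ℝ} (ht : 0 ≤ t)
    (ha : IntervalIntegrable a volume 0 t) (hb : IntervalIntegrable b volume 0 t) :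
    ∫ s in (0 : ℝ)..t, volterraConv a b s =
      volterraConv (fun s => ∫ u in (0 : ℝ)..s, a u) b t := by
  have h := integral_mul_integral_conv (ContinuousLinearMap.mul ℝ ℝ) (w := fun _ => 1) ht
    continuousOn_const ha hb
  simp only [one_mul, ContinuousLinearMap.mul_apply'] at h
  rw [volterraConv,
    ← intervalIntegral.integral_congr fun u _ => intervalIntegral.integral_mul_const _ _, ← h]
  rfl

theorem continuousOn_integral_Ici {h : ℝ → ℝ} (hh : ∀ T, 0 ≤ T → IntervalIntegrable h volume 0 T) :
    ContinuousOn (fun t => ∫ u in (0 : ℝ)..t, h u) (Set.Ici 0) := by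
  intro t ht
  have ht' : (0 : ℝ) ≤ t + 1 := by linarith [Set.mem_Ici.1 ht]
  have hc := intervalIntegral.continuousOn_primitive_interval (μ := volume) (f := h) (a := 0)
    (b := t + 1) ((intervalIntegrable_iff' (by simp)).1 (hh _ ht'))
  rw [Set.uIcc_of_le ht'] at hc
  refine (hc t ⟨ht, by linarith⟩).mono_of_mem_nhdsWithin ?_
  exact mem_nhdsWithin.2 ⟨Set.Iio (t + 1), isOpen_Iio, by simp, fun s hs => ⟨hs.2, hs.1.le⟩⟩

/-- Convolution with `l = 1 - ∫ h`. -/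
theorem volterraConv_one_sub_integral {l h r : ℝ → ℝ}
    (hh : ∀ T, 0 ≤ T → IntervalIntegrable h volume 0 T)
    (hl : ∀ t, 0 ≤ t → l t = 1 - ∫ u in (0 : ℝ)..t, h u) {t : ℝ} (ht : 0 ≤ t)
    (hr : IntervalIntegrable r volume 0 t) :
    volterraConv l r t = (∫ s in (0 : ℝ)..t, r s) - ∫ s in (0 : ℝ)..t, volterraConv h r s := by
  rw [integral_volterraConv ht (hh t ht) hr, volterraConv_congr ht hl fun _ _ => rfl, volterraConv,
    volterraConv, ← intervalIntegral.integral_sub hr]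
  · simp only [sub_mul, one_mul]
  · exact ((continuousOn_integral_Ici hh).mono
      Set.Icc_subset_Ici_self).intervalIntegrable_comp_sub_mul ht hr

/-- A maximum principle for convolution inequalities with a kernel of mass below one. -/
theorem nonpos_of_le_volterraConv {q h : ℝ → ℝ} {T : ℝ} (hT : 0 ≤ T)
    (hq : ContinuousOn q (Set.Icc 0 T)) (hh : IntervalIntegrable h volume 0 T)
    (hpos : ∀ u, 0 < u → 0 ≤ h u) (hmass : ∫ u in (0 : ℝ)..T, h u < 1)
    (hle : ∀ t ∈ Set.Icc 0 T, q t ≤ volterraConv q h t) : ∀ t ∈ Set.Icc 0 T, q t ≤ 0 := by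
  obtain ⟨m, hm, hmax⟩ := isCompact_Icc.exists_isMaxOn (Set.nonempty_Icc.2 hT) hq
  suffices q m ≤ 0 from fun t ht => (hmax ht).trans this
  by_contra! hpm
  have hsub : Set.uIcc 0 m ⊆ Set.uIcc 0 T := by
    rw [Set.uIcc_of_le hm.1, Set.uIcc_of_le hT]
    exact Set.Icc_subset_Icc_right hm.2
  have hhm : IntervalIntegrable h volume 0 m := hh.mono_set hsub
  have h₁ : volterraConv q h m ≤ ∫ u in (0 : ℝ)..m, q m * h u := by
    refine intervalIntegral.integral_mono_on_of_le_Ioo hm.1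
      ((hq.mono (Set.Icc_subset_Icc_right hm.2)).intervalIntegrable_comp_sub_mul hm.1 hhm)
      (hhm.const_mul _) fun u hu => ?_
    exact mul_le_mul_of_nonneg_right
      (hmax (⟨by linarith [hu.2], by linarith [hu.1, hm.2]⟩ : m - u ∈ Set.Icc 0 T)) (hpos u hu.1)
  have h₂ : ∫ u in (0 : ℝ)..m, h u ≤ ∫ u in (0 : ℝ)..T, h u :=
    intervalIntegral.integral_mono_interval le_rfl hm.1 hm.2
      ((ae_restrict_iff' measurableSet_Ioc).2 (ae_of_all _ fun u hu => hpos u hu.1)) hh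
  rw [intervalIntegral.integral_const_mul] at h₁
  -- At a positive maximum, `q m ≤ q m * ∫ h < q m`.
  nlinarith [hle m hm]

/-- A Volterra equation with a non-negative kernel has no nonzero continuous homogeneous
solution. -/
theorem eq_zero_of_eq_volterraConv {q h : ℝ → ℝ} (hq : ContinuousOn q (Set.Ici 0))
    (hh : ∀ T, 0 ≤ T → IntervalIntegrable h volume 0 T) (hpos : ∀ u, 0 < u → 0 ≤ h u)
    (heq : ∀ t, 0 ≤ t → q t = volterraConv q h t) {T : ℝ} (hT : 0 ≤ T) : q T = 0 := by
  have hlim : Tendsto (fun n : ℕ => ∫ u in (0 : ℝ)..T, Real.exp (-(n * u)) * h u) atTop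
      (𝓝 (∫ u in (0 : ℝ)..T, (0 : ℝ))) := by
    refine intervalIntegral.tendsto_integral_filter_of_dominated_convergence (fun u => ‖h u‖)
      (Eventually.of_forall fun n => ?_) (Eventually.of_forall fun n => ae_of_all _ fun u hu => ?_)
      (hh T hT).norm (ae_of_all _ fun u hu => ?_)
    · rw [Set.uIoc_of_le hT]
      exact ((hh T hT).continuousOn_mul (g := fun u => Real.exp (-(n * u)))
        (by fun_prop)).aestronglyMeasurable
    · rw [Set.uIoc_of_le hT] at hu
      have hu0 : (0 : ℝ) ≤ n * u := mul_nonneg n.cast_nonneg hu.1.le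
      rw [norm_mul, Real.norm_of_nonneg (Real.exp_nonneg _)]
      exact mul_le_of_le_one_left (norm_nonneg _) (Real.exp_le_one_iff.2 (neg_nonpos.2 hu0))
    · rw [Set.uIoc_of_le hT] at hu
      rw [← zero_mul (h u)]
      refine Tendsto.mul_const _ (Real.tendsto_exp_neg_atTop_nhds_zero.comp ?_)
      exact tendsto_natCast_atTop_atTop.atTop_mul_const hu.1
  rw [intervalIntegral.integral_zero] at hlim
  -- The weight `exp (-n t)` is multiplicative, so it passes through the convolution; for large `n`
  -- the weighted kernel has mass below one and the maximum principle applies to `|exp (-n t) q t|`.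
  obtain ⟨n, hn⟩ := (hlim.eventually (gt_mem_nhds one_pos)).exists
  have hqc : ContinuousOn q (Set.Icc 0 T) := hq.mono Set.Icc_subset_Ici_self
  have key := nonpos_of_le_volterraConv (q := fun t => |Real.exp (-(n * t)) * q t|)
    (h := fun u => Real.exp (-(n * u)) * h u) hT (by fun_prop)
    ((hh T hT).continuousOn_mul (by fun_prop))
    (fun u hu => mul_nonneg (Real.exp_nonneg _) (hpos u hu)) hn (fun t ht => ?_) T ⟨hT, le_rfl⟩
  · exact (mul_eq_zero.1 (abs_nonpos_iff.1 key)).resolve_left (Real.exp_ne_zero _)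
  · simp only [heq t ht.1, volterraConv]
    rw [← intervalIntegral.integral_const_mul]
    refine (intervalIntegral.abs_integral_le_integral_abs ht.1).trans_eq ?_
    refine intervalIntegral.integral_congr_Ioo_of_le ht.1 fun u hu => ?_
    rw [← abs_of_nonneg (mul_nonneg (Real.exp_nonneg (-(n * u))) (hpos u hu.1)), ← abs_mul]
    congr 1
    rw [show -((n : ℝ) * t) = -(n * (t - u)) + -(n * u) by ring, Real.exp_add]
    ring

/-- A convolution by `l = 1 - ∫ h`, with `h ≥ 0`, can be cancelled. -/
theorem integral_eq_zero_of_volterraConv_eq_zero {l h r : ℝ → ℝ}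
    (hh : ∀ T, 0 ≤ T → IntervalIntegrable h volume 0 T) (hpos : ∀ u, 0 < u → 0 ≤ h u)
    (hl : ∀ t, 0 ≤ t → l t = 1 - ∫ u in (0 : ℝ)..t, h u)
    (hr : ∀ T, 0 ≤ T → IntervalIntegrable r volume 0 T)
    (h0 : ∀ t, 0 ≤ t → volterraConv l r t = 0) {t : ℝ} (ht : 0 ≤ t) :
    ∫ u in (0 : ℝ)..t, r u = 0 := by
  -- Only the primitive of `r` is continuous; the vanishing of `l ∗ r` says that this primitive `q`
  -- solves `q = q ∗ h`.
  refine eq_zero_of_eq_volterraConv (continuousOn_integral_Ici hr) hh hpos (fun s hs => ?_) ht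
  have h₁ := volterraConv_one_sub_integral hh hl hs (hr s hs)
  rw [h0 s hs, intervalIntegral.integral_congr fun u _ => volterraConv_comm h r u,
    integral_volterraConv hs (hr s hs) (hh s hs)] at h₁
  linarith

theorem volterraConv_eq_zero_of_integral_eq_zero {l h r : ℝ → ℝ}
    (hh : ∀ T, 0 ≤ T → IntervalIntegrable h volume 0 T)
    (hl : ∀ t, 0 ≤ t → l t = 1 - ∫ u in (0 : ℝ)..t, h u)
    (hr : ∀ T, 0 ≤ T → IntervalIntegrable r volume 0 T)
    (h0 : ∀ t, 0 ≤ t → ∫ u in (0 : ℝ)..t, r u = 0) {t : ℝ} (ht : 0 ≤ t) :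
    volterraConv l r t = 0 := by
  rw [volterraConv_one_sub_integral hh hl ht (hr t ht), h0 t ht,
    intervalIntegral.integral_congr fun u _ => volterraConv_comm h r u,
    integral_volterraConv ht (hr t ht) (hh t ht),
    volterraConv_congr (a' := fun _ => 0) ht h0 fun _ _ => rfl]
  simp [volterraConv]

theorem continuousOn_volterraConv {y h : ℝ → ℝ} (hy : ContinuousOn y (Set.Ici 0))
    (hh : ∀ T, 0 ≤ T → IntervalIntegrable h volume 0 T) :
    ContinuousOn (volterraConv y h) (Set.Ici 0) := by
  intro t₀ ht₀
  set T := t₀ + 1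
  have hT : (0 : ℝ) ≤ T := add_nonneg ht₀ zero_le_one
  -- Subtracting `y 0` makes the continuous extension vanish at negative arguments, so the variable
  -- upper limit `t` can be replaced by the fixed `T`.
  set z : ℝ → ℝ := fun x => y (Set.projIcc 0 T hT x) - y 0
  have hz : Continuous z :=
    ((hy.mono Set.Icc_subset_Ici_self).comp_continuous
      (continuous_subtype_val.comp continuous_projIcc) fun x => Subtype.coe_prop _).sub
      continuous_const
  obtain ⟨C, hC⟩ := isCompact_Icc.exists_bound_of_continuousOn
    ((hy.mono Set.Icc_subset_Ici_self).sub (continuousOn_const (c := y 0)) :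
      ContinuousOn _ (Set.Icc 0 T))
  have hcont : Continuous fun t => ∫ u in (0 : ℝ)..T, z (t - u) * h u := by
    refine intervalIntegral.continuous_of_dominated_interval (bound := fun u => C * ‖h u‖)
      (fun t => ?_) (fun t => ae_of_all _ fun u _ => ?_) ((hh T hT).norm.const_mul C)
      (ae_of_all _ fun u _ => by fun_prop)
    · rw [Set.uIoc_of_le hT]
      exact ((hh T hT).continuousOn_mul (g := fun u => z (t - u)) (by fun_prop)).aestronglyMeasurable
    · rw [norm_mul]
      exact mul_le_mul_of_nonneg_right (hC _ (Subtype.coe_prop _)) (norm_nonneg _)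
  have heq : ∀ t ∈ Set.Icc 0 T, volterraConv y h t =
      y 0 * (∫ u in (0 : ℝ)..t, h u) + ∫ u in (0 : ℝ)..T, z (t - u) * h u := by
    intro t ht
    have hi : ∀ a ∈ Set.Icc 0 T, ∀ b ∈ Set.Icc 0 T, IntervalIntegrable h volume a b :=
      fun a ha b hb => (hh T hT).mono_set (by
        rw [Set.uIcc_of_le hT]; exact Set.uIcc_subset_Icc ha hb)
    have h0T : (0 : ℝ) ∈ Set.Icc 0 T := ⟨le_rfl, hT⟩
    have hTT : T ∈ Set.Icc 0 T := ⟨hT, le_rfl⟩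
    have hzc : Continuous fun u => z (t - u) := by fun_prop
    rw [← intervalIntegral.integral_add_adjacent_intervals
      ((hi 0 h0T t ht).continuousOn_mul hzc.continuousOn)
      ((hi t ht T hTT).continuousOn_mul hzc.continuousOn)]
    have h₁ : ∫ u in t..T, z (t - u) * h u = 0 := by
      rw [intervalIntegral.integral_congr (g := fun _ => 0), intervalIntegral.integral_zero]
      intro u hu
      rw [Set.uIcc_of_le ht.2] at hu
      simp [z, Set.projIcc_of_le_left hT (sub_nonpos.2 hu.1)]
    rw [h₁, add_zero, ← intervalIntegral.integral_const_mul, ← intervalIntegral.integral_add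
      ((hi 0 h0T t ht).const_mul _) ((hi 0 h0T t ht).continuousOn_mul hzc.continuousOn)]
    refine intervalIntegral.integral_congr fun u hu => ?_
    rw [Set.uIcc_of_le ht.1] at hu
    simp only [z]
    rw [Set.projIcc_of_mem hT (⟨by linarith [hu.2], by linarith [hu.1, ht.2]⟩ : t - u ∈ Set.Icc 0 T)]
    ring
  have hmem : Set.Icc 0 T ∈ 𝓝[Set.Ici 0] t₀ := mem_nhdsWithin.2
    ⟨Set.Iio T, isOpen_Iio, lt_add_one t₀, fun s hs => ⟨hs.2, hs.1.le⟩⟩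
  refine ContinuousWithinAt.mono_of_mem_nhdsWithin ?_ hmem
  have hc : ContinuousOn (fun t => y 0 * (∫ u in (0 : ℝ)..t, h u) +
      ∫ u in (0 : ℝ)..T, z (t - u) * h u) (Set.Icc 0 T) :=
    (continuousOn_const.mul ((continuousOn_integral_Ici hh).mono Set.Icc_subset_Ici_self)).add
      hcont.continuousOn
  exact (hc.congr heq) t₀ ⟨ht₀, (lt_add_one t₀).le⟩

theorem eq_zero_of_forall_integral_eq_zero {g : ℝ → ℝ} (hg : ContinuousOn g (Set.Ici 0))
    (h : ∀ t, 0 ≤ t → ∫ u in (0 : ℝ)..t, g u = 0) {t : ℝ} (ht : 0 < t) : g t = 0 := by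
  have hd : HasDerivAt (fun t => ∫ u in (0 : ℝ)..t, g u) (g t) t :=
    intervalIntegral.integral_hasDerivAt_right
      ((hg.mono (by rw [Set.uIcc_of_le ht.le]; exact Set.Icc_subset_Ici_self)).intervalIntegrable)
      ((hg.mono Set.Ioi_subset_Ici_self).stronglyMeasurableAtFilter isOpen_Ioi t ht)
      (hg.continuousAt (Ici_mem_nhds ht))
  refine hd.unique ((hasDerivAt_const t (0 : ℝ)).congr_of_eventuallyEq ?_)
  filter_upwards [Ioi_mem_nhds ht] with s hs using h s (le_of_lt hs)

/-- The solution of `p = l + β h ∗ p` is non-increasing if `l = 1 - ∫ h ≥ 0` with `h ≥ 0`, and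
`0 ≤ β < 1`. -/
theorem antitoneOn_of_eq_add_volterraConv {l h p : ℝ → ℝ} {β : ℝ}
    (hh : ∀ T, 0 ≤ T → IntervalIntegrable h volume 0 T) (hpos : ∀ u, 0 < u → 0 ≤ h u)
    (hl : ∀ t, 0 ≤ t → l t = 1 - ∫ u in (0 : ℝ)..t, h u) (hl0 : ∀ t, 0 ≤ t → 0 ≤ l t)
    (hβ₀ : 0 ≤ β) (hβ₁ : β < 1) (hp : ContinuousOn p (Set.Ici 0))
    (heq : ∀ t, 0 ≤ t → p t = l t + β * volterraConv p h t) : AntitoneOn p (Set.Ici 0) := by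
  have hmass : ∀ T, 0 ≤ T → ∫ u in (0 : ℝ)..T, β * h u < 1 := fun T hT => by
    rw [intervalIntegral.integral_const_mul]
    have := hl T hT
    have := hl0 T hT
    nlinarith
  have hβh : ∀ u, 0 < u → 0 ≤ β * h u := fun u hu => mul_nonneg hβ₀ (hpos u hu)
  have hint : ∀ {y : ℝ → ℝ}, ContinuousOn y (Set.Ici 0) → ∀ t, 0 ≤ t →
      IntervalIntegrable (fun u => y (t - u) * h u) volume 0 t := fun hy t ht =>
    (hy.mono Set.Icc_subset_Ici_self).intervalIntegrable_comp_sub_mul ht (hh t ht)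
  have hscale : ∀ (q : ℝ → ℝ) t, volterraConv q (fun u => β * h u) t = β * volterraConv q h t :=
    fun q t => by
      rw [volterraConv, volterraConv, ← intervalIntegral.integral_const_mul]
      exact intervalIntegral.integral_congr fun u _ => mul_left_comm _ _ _
  have hsubst : ∀ {y z : ℝ → ℝ}, ContinuousOn y (Set.Ici 0) → ContinuousOn z (Set.Ici 0) →
      ∀ t, 0 ≤ t → volterraConv (fun s => y s - z s) h t =
        volterraConv y h t - volterraConv z h t := fun hy hz t ht => by
    simp only [volterraConv, sub_mul]
    exact intervalIntegral.integral_sub (hint hy t ht) (hint hz t ht)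
  -- The constant `1` is a supersolution, because `l + β ∫ h ≤ l + ∫ h = 1`.
  have hle_one : ∀ t, 0 ≤ t → p t ≤ 1 := fun T hT => by
    have := nonpos_of_le_volterraConv (q := fun t => p t - 1) (h := fun u => β * h u) hT
      ((hp.sub continuousOn_const).mono Set.Icc_subset_Ici_self) ((hh T hT).const_mul β) hβh
      (hmass T hT) (fun t ht => ?_) T ⟨hT, le_rfl⟩
    · linarith
    · rw [hscale, hsubst hp continuousOn_const t ht.1, heq t ht.1]
      have h₁ : volterraConv (fun _ => 1) h t = ∫ u in (0 : ℝ)..t, h u := by simp [volterraConv]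
      rw [h₁]
      have := hl t ht.1
      have := intervalIntegral.integral_nonneg_of_Ioo ht.1 (fun u hu => hpos u hu.1)
      nlinarith
  intro a ha b hb hab
  set δ := b - a
  have hδ : 0 ≤ δ := sub_nonneg.2 hab
  have hpδ : ContinuousOn (fun t => p (t + δ)) (Set.Ici 0) :=
    hp.comp (by fun_prop) fun t ht => add_nonneg ht hδ
  -- In the increment over `δ`, `l` drops by the integral of `h` over `[t, t + δ]`, while the new
  -- part of the convolution adds at most `β` times that integral because `p ≤ 1`.
  have := nonpos_of_le_volterraConv (q := fun t => p (t + δ) - p t) (h := fun u => β * h u) ha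
    ((hpδ.sub hp).mono Set.Icc_subset_Ici_self) ((hh a ha).const_mul β) hβh
    (hmass a ha) (fun t ht => ?_) a ⟨ha, le_rfl⟩
  · have hb' : a + δ = b := add_sub_cancel a b
    rw [hb'] at this
    linarith
  · have htδ : 0 ≤ t + δ := add_nonneg ht.1 hδ
    have htt : t ≤ t + δ := le_add_of_nonneg_right hδ
    rw [hscale, hsubst hpδ hp t ht.1, heq t ht.1, heq _ htδ, hl t ht.1, hl _ htδ]
    have hi₁ := hint hp _ htδ
    have hm : t ∈ Set.uIcc 0 (t + δ) := by rw [Set.uIcc_of_le htδ]; exact ⟨ht.1, htt⟩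
    have s₁ : Set.uIcc 0 t ⊆ Set.uIcc 0 (t + δ) := Set.uIcc_subset_uIcc_left hm
    have s₂ : Set.uIcc t (t + δ) ⊆ Set.uIcc 0 (t + δ) := Set.uIcc_subset_uIcc_right hm
    have e₁ := intervalIntegral.integral_add_adjacent_intervals (hi₁.mono_set s₁)
      (hi₁.mono_set s₂)
    have e₂ := intervalIntegral.integral_add_adjacent_intervals ((hh _ htδ).mono_set s₁)
      ((hh _ htδ).mono_set s₂)
    have e₃ : ∫ u in t..t + δ, p (t + δ - u) * h u ≤ ∫ u in t..t + δ, h u := by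
      refine intervalIntegral.integral_mono_on_of_le_Ioo htt (hi₁.mono_set s₂)
        ((hh _ htδ).mono_set s₂) fun u hu => ?_
      exact mul_le_of_le_one_left (hpos u (ht.1.trans_lt hu.1))
        (hle_one _ (by linarith [hu.2]))
    have e₄ : volterraConv (fun s => p (s + δ)) h t = ∫ u in (0 : ℝ)..t, p (t + δ - u) * h u :=
      intervalIntegral.integral_congr fun u _ => by
        simp only [sub_add_eq_add_sub]
    have e₅ : 0 ≤ ∫ u in t..t + δ, h u :=
      intervalIntegral.integral_nonneg_of_Ioo htt fun u hu => hpos u (ht.1.trans_lt hu.1)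
    have e₆ : volterraConv p h (t + δ) = ∫ u in (0 : ℝ)..t + δ, p (t + δ - u) * h u := rfl
    rw [e₄, e₆, ← e₁, ← e₂]
    nlinarith

theorem IntervalIntegrable.continuousLinearMap_comp {E F : Type*} [NormedAddCommGroup E]
    [NormedSpace ℝ E] [NormedAddCommGroup F] [NormedSpace ℝ F] {f : ℝ → E} {a b : ℝ}
    (hf : IntervalIntegrable f volume a b) (L : E →L[ℝ] F) :
    IntervalIntegrable (fun t => L (f t)) volume a b :=
  ⟨L.integrable_comp hf.1, L.integrable_comp hf.2⟩

/-! ### The master equation and the dilated evolution -/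

namespace QDyn

noncomputable section

variable {H : Type*} [NormedAddCommGroup H] [InnerProductSpace ℂ H]

theorem intervalIntegrable_comp_sub {E : Type*} [NormedAddCommGroup E] {R : ℝ → E} {t : ℝ}
    (hR : IntervalIntegrable R volume 0 t) :
    IntervalIntegrable (fun u => R (t - u)) volume 0 t := by
  have h := (hR.comp_sub_left t).symm
  rwa [sub_zero, sub_self] at h

theorem norm_conv_le {R Φ : ℝ → SuperOp H} {t C : ℝ} (ht : 0 ≤ t)
    (hR : IntervalIntegrable R volume 0 t) (hC : ∀ u ∈ Set.Icc 0 t, ‖Φ u‖ ≤ C) :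
    ‖conv R Φ t‖ ≤ C * ∫ u in (0 : ℝ)..t, ‖R u‖ := by
  have h := intervalIntegral.integral_comp_sub_left (a := 0) (b := t) (fun u => ‖R u‖) t
  rw [sub_self, sub_zero] at h
  rw [← h, ← intervalIntegral.integral_const_mul]
  refine intervalIntegral.norm_integral_le_of_norm_le ht (ae_of_all _ fun u hu => ?_)
    ((intervalIntegrable_comp_sub hR).norm.const_mul C)
  refine (ContinuousLinearMap.opNorm_comp_le _ _).trans ?_
  rw [mul_comm]
  exact mul_le_mul_of_nonneg_right (hC u (Set.Ioc_subset_Icc_self hu)) (norm_nonneg _)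

theorem intervalIntegrable_comp_sub_comp {R Φ : ℝ → SuperOp H} {t : ℝ} (ht : 0 ≤ t)
    (hR : IntervalIntegrable R volume 0 t) (hΦ : ContinuousOn Φ (Set.Icc 0 t)) :
    IntervalIntegrable (fun u => (R (t - u)).comp (Φ u)) volume 0 t := by
  obtain ⟨C, hC⟩ := isCompact_Icc.exists_bound_of_continuousOn hΦ
  have hR' := intervalIntegrable_comp_sub hR
  rw [intervalIntegrable_iff_integrableOn_Ioc_of_le ht] at hR' ⊢
  refine Integrable.mono' (hR'.norm.const_mul C) ?_ ?_
  · exact (ContinuousLinearMap.compL ℂ (Op H) (Op H) (Op H)).aestronglyMeasurable_comp₂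
      hR'.aestronglyMeasurable
      ((hΦ.mono Set.Ioc_subset_Icc_self).aestronglyMeasurable measurableSet_Ioc)
  · refine (ae_restrict_iff' measurableSet_Ioc).2 (ae_of_all _ fun u hu => ?_)
    refine (ContinuousLinearMap.opNorm_comp_le _ _).trans ?_
    rw [mul_comm]
    exact mul_le_mul_of_nonneg_right (hC u (Set.Ioc_subset_Icc_self hu)) (norm_nonneg _)

theorem conv_zero (R Φ : ℝ → SuperOp H) : conv R Φ 0 = 0 :=
  intervalIntegral.integral_same

/-- The integrated master equation `Φ = Id + R ∗ Φ`. -/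
theorem IsGovernedBy.eq_id_add_conv {K : MemoryKernel H} {Φ : ℝ → SuperOp H}
    (h : IsGovernedBy K Φ) {t : ℝ} (ht : 0 ≤ t) :
    Φ t = ContinuousLinearMap.id ℂ (Op H) + conv K.primitive Φ t := by
  rcases ht.eq_or_lt with rfl | ht
  · rw [conv_zero, add_zero, h.zero]
  have hd : ∀ s, 0 < s → HasDerivAt (fun s => Φ s - conv K.primitive Φ s) 0 s := fun s hs => by
    obtain ⟨D, hD₁, hD₂⟩ := h.eqn s hs
    have h := hD₁.sub hD₂
    rw [sub_self] at h
    exact h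
  have hconst : ∀ s, 0 < s → Φ s - conv K.primitive Φ s = Φ t - conv K.primitive Φ t :=
    fun s hs => isOpen_Ioi.is_const_of_deriv_eq_zero isPreconnected_Ioi
      (fun x hx => (hd x hx).differentiableAt.differentiableWithinAt)
      (fun x hx => (hd x hx).deriv) hs ht
  obtain ⟨C, hC⟩ := isCompact_Icc.exists_bound_of_continuousOn
    (h.cont.mono (Set.Icc_subset_Ici_self : Set.Icc (0 : ℝ) 1 ⊆ _))
  have hΦ : Tendsto Φ (𝓝[>] 0) (𝓝 (ContinuousLinearMap.id ℂ (Op H))) := by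
    rw [← h.zero]
    exact (h.cont 0 (Set.mem_Ici.2 le_rfl)).mono_left
      (nhdsWithin_mono _ Set.Ioi_subset_Ici_self)
  -- The equation holds only for positive times, so the integration constant is found from the limit
  -- at `0`; there the convolution is bounded by `C ∫ ‖R‖`, which tends to zero.
  have hK : Tendsto (conv K.primitive Φ) (𝓝[>] 0) (𝓝 0) := by
    have hn := (continuousOn_integral_Ici fun T hT => (K.locallyIntegrable T hT).norm) 0
      (Set.mem_Ici.2 le_rfl)
    have hn' := (hn.mono_left (nhdsWithin_mono _ Set.Ioi_subset_Ici_self)).const_mul C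
    simp only [intervalIntegral.integral_same, mul_zero] at hn'
    refine squeeze_zero_norm' ?_ hn'
    filter_upwards [Ioc_mem_nhdsGT (zero_lt_one' ℝ)] with s hs
    exact norm_conv_le hs.1.le (K.locallyIntegrable s hs.1.le)
      fun u hu => hC u ⟨hu.1, hu.2.trans hs.2⟩
  have hlim := (hΦ.sub hK).congr' (f₂ := fun _ => Φ t - conv K.primitive Φ t)
    (by filter_upwards [self_mem_nhdsWithin] with s hs using hconst s hs)
  rw [sub_zero] at hlim
  rw [tendsto_nhds_unique hlim tendsto_const_nhds, sub_add_cancel]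

variable [CompleteSpace H]

/-- Evaluation of a real functional on the convolution. -/
theorem map_conv_apply {R Φ : ℝ → SuperOp H} {t : ℝ} (ht : 0 ≤ t)
    (hR : IntervalIntegrable R volume 0 t) (hΦ : ContinuousOn Φ (Set.Icc 0 t))
    (m : Op H →L[ℝ] ℝ) (Z : Op H) :
    m (conv R Φ t Z) = ∫ u in (0 : ℝ)..t, m (R (t - u) (Φ u Z)) := by
  have hi := intervalIntegrable_comp_sub_comp ht hR hΦ
  exact ((m.comp ((ContinuousLinearMap.apply ℂ (Op H) Z).restrictScalars
    ℝ)).intervalIntegral_comp_comm hi).symm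

variable {Φ : ℝ → SuperOp H} {K : MemoryKernel H}

theorem IsGovernedBy.map_apply_eq (h : IsGovernedBy K Φ) {t : ℝ} (ht : 0 ≤ t)
    (m : Op H →L[ℝ] ℝ) (Z : Op H) :
    m (Φ t Z) = m Z + ∫ u in (0 : ℝ)..t, m (K.primitive (t - u) (Φ u Z)) := by
  rw [← map_conv_apply ht (K.locallyIntegrable t ht) (h.cont.mono Set.Icc_subset_Ici_self),
    ← map_add]
  conv_lhs => rw [h.eq_id_add_conv ht]
  rfl

theorem MemoryKernel.intervalIntegrable_map_apply (K : MemoryKernel H) (m : Op H →L[ℝ] ℝ)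
    (Z : Op H) {T : ℝ} (hT : 0 ≤ T) :
    IntervalIntegrable (fun u => m (K.primitive u Z)) volume 0 T :=
  (K.locallyIntegrable T hT).continuousLinearMap_comp
    (m.comp ((ContinuousLinearMap.apply ℂ (Op H) Z).restrictScalars ℝ))

variable (H) in
/-- The real bilinear pairing `(R, Z) ↦ m (R Z)` for a real functional `m`. -/
def evalPairing (m : Op H →L[ℝ] ℝ) : SuperOp H →L[ℝ] Op H →L[ℝ] ℝ :=
  (ContinuousLinearMap.compL ℝ (Op H) (Op H) ℝ m).comp
    (ContinuousLinearMap.restrictScalarsL ℂ (Op H) (Op H) ℝ ℝ)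

@[simp] theorem evalPairing_apply (m : Op H →L[ℝ] ℝ) (R : SuperOp H) (Z : Op H) :
    evalPairing H m R Z = m (R Z) := rfl

variable [FiniteDimensional ℂ H]

/-- The eigenvalue of a P divisible evolution decreases: it is `1 - ∫ h` with `h ≥ 0`. -/
theorem IsJointEigenvector.exists_density {l : ℝ → ℝ} {X : Op H}
    (hX : IsJointEigenvector Φ l X) (hdyn : IsDynamicalMap Φ) (hherm : IsHermitian Φ)
    (hdiv : IsPDivisible Φ) (hgov : IsGovernedBy K Φ)
    (hint : ∀ T, 0 ≤ T → IntervalIntegrable (deriv Φ) volume 0 T) :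
    ∃ h : ℝ → ℝ, (∀ T, 0 ≤ T → IntervalIntegrable h volume 0 T) ∧ (∀ u, 0 < u → 0 ≤ h u) ∧
      ∀ t, 0 ≤ t → l t = 1 - ∫ u in (0 : ℝ)..t, h u := by
  obtain ⟨m, -, hm⟩ := exists_dual_vector ℂ X (norm_ne_zero_iff.2 hX.ne_zero)
  let n : SuperOp H →L[ℝ] ℝ := ‖X‖⁻¹ • Complex.reCLM.comp
    ((m.comp (ContinuousLinearMap.apply ℂ (Op H) X)).restrictScalars ℝ)
  have hn : ∀ t, 0 ≤ t → n (Φ t) = l t := fun t ht => by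
    have hne : ‖X‖ ≠ 0 := norm_ne_zero_iff.2 hX.ne_zero
    change ‖X‖⁻¹ • (m (Φ t X)).re = l t
    rw [hX.map_eq t ht, map_smul, hm]
    simp
    field_simp
  have hd : ∀ t, 0 < t → HasDerivAt l (n (deriv Φ t)) t := fun t ht => by
    obtain ⟨D, hD, -⟩ := hgov.eqn t ht
    refine (n.hasFDerivAt.comp_hasDerivAt t hD.differentiableAt.hasDerivAt).congr_of_eventuallyEq ?_
    filter_upwards [Ioi_mem_nhds ht] with s hs using (hn s (le_of_lt hs)).symm
  have hi : ∀ T, 0 ≤ T → IntervalIntegrable (fun t => n (deriv Φ t)) volume 0 T :=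
    fun T hT => (hint T hT).continuousLinearMap_comp n
  refine ⟨fun t => -n (deriv Φ t), fun T hT => (hi T hT).neg, fun u hu => ?_, fun t ht => ?_⟩
  · have hnp := (hX.antitoneOn hdyn hherm hdiv hgov.cont).derivWithin_nonpos (x := u)
    rw [(hd u hu).hasDerivWithinAt.derivWithin (uniqueDiffOn_Ici 0 u hu.le)] at hnp
    exact neg_nonneg.2 hnp
  · rw [intervalIntegral.integral_neg, intervalIntegral.integral_eq_sub_of_hasDerivAt_of_le ht
      ((hX.continuousOn hgov.cont).mono Set.Icc_subset_Ici_self) (fun s hs => hd s hs.1) (hi t ht),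
      hX.eigenvalue_zero hdyn]
    ring

/-- Every nonzero operator is detected by a left eigenfunctional of the evolution. -/
theorem IsDynamicalMap.exists_eigenfunctional (hdyn : IsDynamicalMap Φ)
    (hcomm : IsCommutative Φ) (hherm : IsHermitian Φ) {Y : Op H} (hY : Y ≠ 0) :
    ∃ (l : ℝ → ℝ) (X : Op H) (m : Op H →L[ℝ] ℝ), IsJointEigenvector Φ l X ∧
      (∀ t, 0 ≤ t → ∀ Z, m (Φ t Z) = l t * m Z) ∧ m Y = 1 := by
  obtain ⟨l, X, hX, hXY⟩ : ∃ l X, IsJointEigenvector Φ l X ∧ tr (star X * Y) ≠ 0 := by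
    by_contra! hall
    refine hY (eq_zero_of_tr_star_mul_self ?_)
    exact hdyn.induction_joint_eigenvector hcomm hherm (P := fun Z => tr (star Z * Y) = 0)
      (by simp [tr]) (fun Z W hZ hW => by rw [star_add, add_mul, tr_add, hZ, hW, add_zero])
      hall Y
  let m : Op H →L[ℝ] ℝ := Complex.reCLM.comp (((tr (star X * Y))⁻¹ •
    (trL H).comp (ContinuousLinearMap.mul ℂ (Op H) (star X))).restrictScalars ℝ)
  have hm : ∀ Z, m Z = ((tr (star X * Y))⁻¹ * tr (star X * Z)).re := fun Z => rfl
  refine ⟨l, X, m, hX, fun t ht Z => ?_, ?_⟩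
  · rw [hm, hm, ← hdyn.tr_star_map_mul hherm ht, hX.map_eq t ht, star_smul, smul_mul_assoc, tr_smul,
      mul_left_comm, RCLike.star_def, Complex.conj_ofReal, Complex.re_ofReal_mul]
  · rw [hm, inv_mul_cancel₀ hXY, Complex.one_re]

/-- The memory kernel of a P divisible evolution acts diagonally on its eigenfunctionals. -/
theorem volterraConv_map_primitive (hdyn : IsDynamicalMap Φ) (hcomm : IsCommutative Φ)
    (hherm : IsHermitian Φ) (hdiv : IsPDivisible Φ) (hgov : IsGovernedBy K Φ)
    (hint : ∀ T, 0 ≤ T → IntervalIntegrable (deriv Φ) volume 0 T) {l : ℝ → ℝ} {X : Op H}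
    (hX : IsJointEigenvector Φ l X) {m : Op H →L[ℝ] ℝ}
    (hm : ∀ t, 0 ≤ t → ∀ Z, m (Φ t Z) = l t * m Z) (Z : Op H) :
    ∀ t, 0 ≤ t → volterraConv l (fun u => m (K.primitive u Z)) t = (l t - 1) * m Z := by
  have hlc : ∀ t, ContinuousOn l (Set.Icc 0 t) := fun t =>
    (hX.continuousOn hgov.cont).mono Set.Icc_subset_Ici_self
  have hri := fun Z T hT => K.intervalIntegrable_map_apply m Z (T := T) hT
  refine hdyn.induction_joint_eigenvector hcomm hherm
    (P := fun Z => ∀ t, 0 ≤ t → volterraConv l (fun u => m (K.primitive u Z)) t = (l t - 1) * m Z)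
    (fun t _ => ?_) (fun Z W hZ hW t ht => ?_) (fun l' X' hX' => ?_) Z
  · simp [volterraConv]
  · rw [map_add, mul_add, ← hZ t ht, ← hW t ht, volterraConv, volterraConv, volterraConv,
      ← intervalIntegral.integral_add ((hlc t).intervalIntegrable_comp_sub_mul ht (hri Z t ht))
        ((hlc t).intervalIntegrable_comp_sub_mul ht (hri W t ht))]
    simp only [map_add, mul_add]
  · have hsmul : ∀ (a : ℝ) (R : SuperOp H), m (R ((a : ℂ) • X')) = m (R X') * a := fun a R => by
      rw [map_smul, Complex.coe_smul, map_smul, smul_eq_mul, mul_comm]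
    have hl' : ∀ t, 0 ≤ t → m (Φ t X') = l' t * m X' := fun t ht => by
      rw [hX'.map_eq t ht, mul_comm]
      exact hsmul (l' t) (ContinuousLinearMap.id ℂ _)
    have hconv : ∀ t, 0 ≤ t →
        volterraConv l' (fun u => m (K.primitive u X')) t = (l' t - 1) * m X' := fun t ht => by
      have h := hgov.map_apply_eq ht m X'
      rw [hl' t ht, intervalIntegral.integral_congr (g := fun u => m (K.primitive (t - u) X') * l' u)]
        at h
      · rw [volterraConv_comm, volterraConv]
        linarith
      · intro u hu
        rw [Set.uIcc_of_le ht] at hu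
        simp only [hX'.map_eq u hu.1, hsmul]
    -- If `m X' = 0`, cancelling `l'` shows that the primitive of `m (R X')` vanishes, hence so does
    -- its convolution with `l`. Otherwise evaluating `m (Φ t X')` in two ways gives `l = l'`.
    by_cases h0 : m X' = 0
    · obtain ⟨h, hh, -, hl⟩ := hX.exists_density hdyn hherm hdiv hgov hint
      obtain ⟨h', hh', hpos', hl''⟩ := hX'.exists_density hdyn hherm hdiv hgov hint
      rw [h0]
      intro t ht
      rw [mul_zero]
      refine volterraConv_eq_zero_of_integral_eq_zero hh hl (hri X') (fun s hs => ?_) ht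
      exact integral_eq_zero_of_volterraConv_eq_zero hh' hpos' hl'' (hri X')
        (fun s hs => by rw [hconv s hs, h0, mul_zero]) hs
    · have hll : ∀ t, 0 ≤ t → l t = l' t := fun t ht =>
        mul_right_cancel₀ h0 ((hm t ht X').symm.trans (hl' t ht))
      intro t ht
      rw [volterraConv_congr ht hll fun _ _ => rfl, hll t ht, hconv t ht]

/-- The diagonal entries of the dilated evolution are non-increasing if the original evolution is
P divisible. -/
theorem antitoneOn_map_dilated (hdyn : IsDynamicalMap Φ) (hcomm : IsCommutative Φ)
    (hherm : IsHermitian Φ) (hdiv : IsPDivisible Φ) (hgov : IsGovernedBy K Φ)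
    (hint : ∀ T, 0 ≤ T → IntervalIntegrable (deriv Φ) volume 0 T) {α : ℝ} (hα₀ : 0 < α)
    (hα₁ : α < 1) {Φt : ℝ → SuperOp H} (hgovt : IsGovernedBy (K.scale (α ^ 2)) Φt)
    {l : ℝ → ℝ} {X : Op H} (hX : IsJointEigenvector Φ l X) {m : Op H →L[ℝ] ℝ}
    (hm : ∀ t, 0 ≤ t → ∀ Z, m (Φ t Z) = l t * m Z) {Y : Op H} (hY : m Y = 1) :
    AntitoneOn (fun t => m (Φt t Y)) (Set.Ici 0) := by
  obtain ⟨h, hh, hpos, hl⟩ := hX.exists_density hdyn hherm hdiv hgov hint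
  have hlc := hX.continuousOn hgov.cont
  have hΦtY : ContinuousOn (fun t => Φt t Y) (Set.Ici 0) := hgovt.cont.clm_apply continuousOn_const
  set y : ℝ → ℝ := fun t => m (Φt t Y) with hy
  have hyc : ContinuousOn y (Set.Ici 0) := m.continuous.comp_continuousOn hΦtY
  have hii : ∀ {z : ℝ → ℝ}, ContinuousOn z (Set.Ici 0) → ∀ t, 0 ≤ t →
      IntervalIntegrable z volume 0 t := fun hz t ht =>
    (hz.mono (by rw [Set.uIcc_of_le ht]; exact Set.Icc_subset_Ici_self)).intervalIntegrable
  have hyeq : ∀ t, 0 ≤ t →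
      y t = 1 + α ^ 2 * ∫ u in (0 : ℝ)..t, evalPairing H m (K.primitive (t - u)) (Φt u Y) :=
    fun t ht => by
      have e := hgovt.map_apply_eq ht m Y
      rw [hY] at e
      rw [hy, ← intervalIntegral.integral_const_mul]
      refine e.trans ?_
      congr 1
      refine intervalIntegral.integral_congr fun u _ => ?_
      exact map_smul m (α ^ 2) _
  -- Convolve the integrated equation for `y` with `l` and apply Fubini: the inner integral becomes
  -- `(l (t - u) - 1) * y u`, which eliminates the kernel.
  have hconv : ∀ t, 0 ≤ t → volterraConv l y t - ∫ s in (0 : ℝ)..t, l s =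
      α ^ 2 * (volterraConv l y t - ∫ s in (0 : ℝ)..t, y s) := fun t ht => by
    have hlt : ContinuousOn l (Set.Icc 0 t) := hlc.mono Set.Icc_subset_Ici_self
    have hly := hlt.intervalIntegrable_comp_sub_mul ht (hii hyc t ht)
    have hlint := intervalIntegral.integral_comp_sub_left (a := 0) (b := t) l t
    rw [sub_self, sub_zero] at hlint
    have hfub := integral_mul_integral_conv (evalPairing H m) ht hlt (K.locallyIntegrable t ht)
      ((hΦtY.mono (by rw [Set.uIcc_of_le ht]; exact Set.Icc_subset_Ici_self)).intervalIntegrable)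
    have hright : ∫ u in (0 : ℝ)..t, ∫ v in (0 : ℝ)..t - u,
        l (t - u - v) * evalPairing H m (K.primitive v) (Φt u Y) =
        volterraConv l y t - ∫ s in (0 : ℝ)..t, y s := by
      rw [volterraConv, ← intervalIntegral.integral_sub hly (hii hyc t ht)]
      refine intervalIntegral.integral_congr fun u hu => ?_
      rw [Set.uIcc_of_le ht] at hu
      refine (volterraConv_map_primitive hdyn hcomm hherm hdiv hgov hint hX hm (Φt u Y) (t - u)
        (sub_nonneg.2 hu.2)).trans ?_
      rw [sub_mul, one_mul]
    rw [← hright, ← hfub, ← intervalIntegral.integral_const_mul, ← hlint, volterraConv,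
      ← intervalIntegral.integral_sub hly (intervalIntegrable_comp_sub (hii hlc t ht))]
    refine intervalIntegral.integral_congr fun s hs => ?_
    rw [Set.uIcc_of_le ht] at hs
    simp only [hyeq s hs.1]
    ring
  have hvc : ContinuousOn (volterraConv y h) (Set.Ici 0) := continuousOn_volterraConv hyc hh
  -- Substituting `l ∗ y = ∫ y - ∫ h ∗ y` gives the renewal equation in integrated form; continuity
  -- then removes the integral.
  have hzero : ∀ t, 0 ≤ t →
      ∫ s in (0 : ℝ)..t, (y s - (l s + (1 - α ^ 2) * volterraConv y h s)) = 0 := fun t ht => by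
    have e₁ := volterraConv_one_sub_integral hh hl ht (hii hyc t ht)
    rw [intervalIntegral.integral_congr fun u _ => volterraConv_comm h y u] at e₁
    have e₂ := hconv t ht
    rw [intervalIntegral.integral_sub (hii hyc t ht)
      ((hii hlc t ht).add ((hii hvc t ht).const_mul _)),
      intervalIntegral.integral_add (hii hlc t ht) ((hii hvc t ht).const_mul _),
      intervalIntegral.integral_const_mul]
    rw [e₁] at e₂
    linarith
  refine antitoneOn_of_eq_add_volterraConv (β := 1 - α ^ 2) hh hpos hl
    (fun t ht => hX.eigenvalue_nonneg hdyn hherm hdiv hgov.cont ht) (by nlinarith) (by nlinarith)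
    hyc fun t ht => ?_
  rcases ht.eq_or_lt with rfl | ht
  · rw [hl 0 le_rfl]
    simp [volterraConv, hy, hgovt.zero, hY]
  · exact sub_eq_zero.1 (eq_zero_of_forall_integral_eq_zero
      (hyc.sub (hlc.add (continuousOn_const.mul hvc))) hzero ht)

end

end QDyn

theorem proposition1 {H : Type*} [NormedAddCommGroup H] [InnerProductSpace ℂ H]
    [FiniteDimensional ℂ H] [CompleteSpace H]
    -- the original commutative Hermitian dynamical map and its memory kernel
    (K : QDyn.MemoryKernel H) (Φ : ℝ → QDyn.SuperOp H)
    (hdyn : QDyn.IsDynamicalMap Φ) (hcomm : QDyn.IsCommutative Φ) (hherm : QDyn.IsHermitian Φ)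
    (hgov : QDyn.IsGovernedBy K Φ)
    -- the dilation parameter and the norm condition on the Laplace transform of `dΦ/dt`
    (α : ℝ) (hα₀ : 0 < α) (hα₁ : α < 1)
    (s : ℂ) (F : QDyn.SuperOp H) (hs : QDyn.HasLaplaceTransform (deriv Φ) s F)
    (hnorm : (1 - α ^ 2) * QDyn.norm11 F < 1)
    -- the map governed by the dilated kernel
    (Φt : ℝ → QDyn.SuperOp H) (hgovt : QDyn.IsGovernedBy (K.scale (α ^ 2)) Φt)
    -- its derivative has a positive eigenvalue at some time
    (hpos : ∃ t : ℝ, 0 ≤ t ∧ ∃ D : QDyn.SuperOp H, HasDerivWithinAt Φt D (Set.Ici 0) t ∧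
      ∃ c : ℝ, 0 < c ∧
        Module.End.HasEigenvalue (D : QDyn.Op H →ₗ[ℂ] QDyn.Op H) (c : ℂ)) :
    ¬ QDyn.IsPDivisible Φ := by
  intro hdiv
  obtain ⟨t, ht, D, hD, c, hc, hev⟩ := hpos
  obtain ⟨Y, hY⟩ := hev.exists_hasEigenvector
  obtain ⟨l, X, m, hX, hm, hmY⟩ := hdyn.exists_eigenfunctional hcomm hherm hY.2
  have hanti := QDyn.antitoneOn_map_dilated hdyn hcomm hherm hdiv hgov hs.1 hα₀ hα₁ hgovt hX hm hmY
  have hDY : D Y = c • Y := hY.apply_eq_smul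
  have hd : HasDerivWithinAt (fun t => m (Φt t Y)) c (Set.Ici 0) t := by
    have h := ((m.comp ((ContinuousLinearMap.apply ℂ (QDyn.Op H) Y).restrictScalars
      ℝ)).hasFDerivAt.comp_hasDerivWithinAt t hD)
    have hval : m (D Y) = c := by rw [hDY, map_smul, hmY, smul_eq_mul, mul_one]
    rw [← hval]
    exact h
  have hle := hanti.derivWithin_nonpos (x := t)
  -- Derivatives within `[0, ∞)` are unique even at `t = 0`, so the one-sided case is covered as
  -- well.
  rw [hd.derivWithin (uniqueDiffOn_Ici 0 t ht)] at hle
  exact hc.not_ge hle
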